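/- Max Cover with private elements: the public input is a universe $\mathcal U$ of $n\ge 1$ elements, sets $S_1,\dots,S_m\subseteq\mathcal U$, an integer $0\le k\le m$ and a real $\varepsilon>0$; the private input is a subset $R\subseteq\mathcal U$. The output is a set $J$ of exactly $k$ indices, with coverage $\mathrm{cov}_R(J)=|R\cap\bigcup_{j\in J}S_j|$, and $\mathrm{OPT}_R=\max_{|J|=k}\mathrm{cov}_R(J)$. Let $f=\max_{u\in\mathcal U}|\{i: u\in S_i\}|$ be the maximum element degree. A randomized algorithm is $\varepsilon$-node differentially private if, for every public input, every pair $R_1,R_2$ with $|R_1\triangle R_2|=1$ and every set $Y$ of outputs, the probability of an output in $Y$ on $R_1$ is at most $e^{\varepsilon}$ times that on $R_2$. A randomized algorithm whose private input is the set system itself (over a public universe) is $\varepsilon$-edge differentially private if the same inequality holds for every two set systems $(S_i)_{i\le m},(S_i')_{i\le m}$ which differ in exactly one index $i$, with $|S_i\triangle S_i'|=1$. **Corollary.** There is an absolute constant $c\in\mathbb N$ such that for every $\eta>0$ there is a constant $C>0$, depending only on $\eta$, for which the following hold. 1. There is an $\varepsilon$-node differentially private algorithm for Max Cover (for every $\varepsilon>0$)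 which, on every input, outputs with probability at least $1-1/n^2$ a set $J$ with $$\mathrm{cov}_R(J)\ \ge\ \Bigl(1-\frac1e-\eta\Bigr)\mathrm{OPT}_R-C\,(\log n)^c\,\frac{fk}{\varepsilon};$$ that is, it achieves a $(1-1/e-\eta,\tilde O(fk/\varepsilon))$-approximation with high probability. 2. There is an algorithm $\mathcal B$ for Max Cover with a privacy parameter, which is $\varepsilon$-edge differentially private when run with any parameter $\varepsilon>0$, such that for every $\varepsilon>0$ and every $\mathcal U,S_1,\dots,S_m,k$ as above with $f\ge1$, running $\mathcal B$ with parameter $\varepsilon/f$ on the restricted system $S_1\cap R,\dots,S_m\cap R$ is $\varepsilon$-node differentially private and, for every $R$, with probability at least $1-1/n^2$ outputs a set $J$ with $$\mathrm{cov}_R(J)\ \ge\ \Bigl(1-\frac1e-\eta\Bigr)\mathrm{OPT}_R-C\,(\log (n+m))^c\,\frac{fk}{\varepsilon}.$$ -/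

import Mathlib

/-- A set system `S₁, …, Sₘ` over the universe `Fin n` of `n` elements. -/
abbrev SetSystem (n m : ℕ) := Fin m → Finset (Fin n)

namespace SetSystem

/-- The maximum element degree `f`: the largest number of sets containing a common element. -/
def maxDegree {n m : ℕ} (S : SetSystem n m) : ℕ :=
  Finset.univ.sup fun u : Fin n => (Finset.univ.filter fun i : Fin m => u ∈ S i).card

/-- The number of elements covered by the sets with indices in `J`. -/
def coverage {n m : ℕ} (S : SetSystem n m) (J : Finset (Fin m)) : ℕ :=
  (J.biUnion S).card

/-- The Max Cover optimum: the largest coverage of `k` of the sets. -/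
def opt {n m : ℕ} (S : SetSystem n m) (k : ℕ) : ℕ :=
  (Finset.powersetCard k Finset.univ).sup S.coverage

/-- The restricted system `S₁ ∩ R, …, Sₘ ∩ R`. -/
def restrict {n m : ℕ} (S : SetSystem n m) (R : Finset (Fin n)) : SetSystem n m :=
  fun i => S i ∩ R

end SetSystem

/-- A feasible Max Cover output: (the indices of) exactly `k` of the `m` sets. -/
abbrev Solution (m k : ℕ) := {J : Finset (Fin m) // J.card = k}

/-- Two set systems over the same universe are edge-neighbors if they differ in exactly one set,
and that set differs by exactly one element. -/
def EdgeNeighbor {n m : ℕ} (S₁ S₂ : SetSystem n m) : Prop :=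
  ∃ i, (symmDiff (S₁ i) (S₂ i)).card = 1 ∧ ∀ j, j ≠ i → S₁ j = S₂ j

/-- Two private subsets of the universe are node-neighbors if they differ by exactly one element. -/
def NodeNeighbor {n : ℕ} (R₁ R₂ : Finset (Fin n)) : Prop :=
  (symmDiff R₁ R₂).card = 1

/-- Pure `ε`-differential privacy of a randomized mechanism `M` with respect to a neighboring
relation on its private inputs. -/
def IsDP {X Y : Type} (Neighbor : X → X → Prop) (ε : ℝ) (M : X → PMF Y) : Prop :=
  ∀ x₁ x₂ : X, Neighbor x₁ x₂ → ∀ E : Set Y,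
    (M x₁).toOuterMeasure E ≤ ENNReal.ofReal (Real.exp ε) * (M x₂).toOuterMeasure E

/-- A random choice `P` of `k` sets is an `(α, β)`-approximation for Max Cover on `S` with
probability at least `p`. -/
def IsApproxWithProb {n m k : ℕ} (S : SetSystem n m) (α β p : ℝ) (P : PMF (Solution m k)) :
    Prop :=
  p ≤ (P.toOuterMeasure
    {J : Solution m k | α * (S.opt k : ℝ) - β ≤ (S.coverage J.1 : ℝ)}).toReal

/-- A randomized Max Cover algorithm for the node model: for `k ≤ m` and a privacy parameter, it
takes the public set system and the private set `R` of elements to be covered. -/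
abbrev NodeAlgorithm :=
  ∀ n m k : ℕ, k ≤ m → ℝ → SetSystem n m → Finset (Fin n) → PMF (Solution m k)

/-- A randomized Max Cover algorithm for the edge model: for `k ≤ m` and a privacy parameter, it
takes the private set system. -/
abbrev EdgeAlgorithm :=
  ∀ n m k : ℕ, k ≤ m → ℝ → SetSystem n m → PMF (Solution m k)

/-! No bound on running time is asked for, so the exponential mechanism with coverage as score
suffices. Moving to a node- or edge-neighbor changes every coverage by at most 1, which gives
privacy (`isDP_expMechanism`). With `N` candidates, one of them optimal, the loss is `O((log N + log
n) / ε)` against the full optimum, so the factor `1 - 1/e - η` is used only through being at most 1.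

In the node model the error may not depend on `m`. Empty sets never help, and double counting
incidences leaves at most `n f` nonempty ones, so about `(n f) ^ k` candidates, chosen from public
data alone, contain an optimum for every `R` (`exists_candidates`); `log f ≤ f` is absorbed by the
factor `f`. In the edge model all at most `m ^ k` solutions compete, and parameter `ε / f` turns an
error of order `k / ε` into `f k / ε`. -/

/-! ### The exponential mechanism -/

section ExponentialMechanism

variable {Y : Type}

/-- The weights `exp (ε q / 2)` of the exponential mechanism on the candidates in `s`. -/
noncomputable def expWeight (ε : ℝ) (s : Finset Y) (q : Y → ℝ) : Y → ENNReal :=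
  (s : Set Y).indicator fun y => ENNReal.ofReal (Real.exp (ε * q y / 2))

theorem expWeight_ne_top (ε : ℝ) (s : Finset Y) (q : Y → ℝ) (y : Y) :
    expWeight ε s q y ≠ ⊤ := by
  unfold expWeight
  by_cases h : y ∈ (s : Set Y) <;> simp [h]

theorem tsum_expWeight_ne_zero (ε : ℝ) {s : Finset Y} (hs : s.Nonempty) (q : Y → ℝ) :
    ∑' y, expWeight ε s q y ≠ 0 := by
  obtain ⟨y, hy⟩ := hs
  refine fun h => absurd (ENNReal.tsum_eq_zero.1 h y) ?_
  simp [expWeight, hy, Real.exp_pos]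

theorem tsum_expWeight_ne_top [Fintype Y] (ε : ℝ) (s : Finset Y) (q : Y → ℝ) :
    ∑' y, expWeight ε s q y ≠ ⊤ := by
  rw [tsum_fintype]
  exact ENNReal.sum_ne_top.2 fun y _ => expWeight_ne_top ε s q y

/-- The exponential mechanism: choose a candidate `y ∈ s` with probability proportional to
`exp (ε q(y) / 2)`. -/
noncomputable def expMechanism [Fintype Y] (ε : ℝ) (s : Finset Y) (hs : s.Nonempty) (q : Y → ℝ) : PMF Y :=
  PMF.normalize (expWeight ε s q) (tsum_expWeight_ne_zero ε hs q) (tsum_expWeight_ne_top ε s q)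

theorem expWeight_le_mul {ε : ℝ} (hε : 0 ≤ ε) (s : Finset Y) {q₁ q₂ : Y → ℝ} {y : Y}
    (h : q₁ y ≤ q₂ y + 1) :
    expWeight ε s q₁ y ≤ ENNReal.ofReal (Real.exp (ε / 2)) * expWeight ε s q₂ y := by
  unfold expWeight
  by_cases hy : y ∈ (s : Set Y)
  · rw [Set.indicator_of_mem hy, Set.indicator_of_mem hy,
      ← ENNReal.ofReal_mul (Real.exp_pos _).le, ← Real.exp_add]
    refine ENNReal.ofReal_le_ofReal (Real.exp_le_exp.2 ?_)
    nlinarith [mul_le_mul_of_nonneg_left h hε]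
  · simp [hy]

/-- The exponential mechanism is `ε`-differentially private for scores of sensitivity one. -/
theorem isDP_expMechanism [Fintype Y] {X : Type} {Neighbor : X → X → Prop} {ε : ℝ} (hε : 0 ≤ ε)
    (s : Finset Y) (hs : s.Nonempty) (q : X → Y → ℝ)
    (hq : ∀ x₁ x₂, Neighbor x₁ x₂ → ∀ y, q x₁ y ≤ q x₂ y + 1 ∧ q x₂ y ≤ q x₁ y + 1) :
    IsDP Neighbor ε fun x => expMechanism ε s hs (q x) := by
  intro x₁ x₂ hx E
  rw [PMF.toOuterMeasure_apply, PMF.toOuterMeasure_apply, ← ENNReal.tsum_mul_left]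
  refine ENNReal.tsum_le_tsum fun y => ?_
  by_cases hy : y ∈ E
  swap
  · simp [hy]
  simp only [Set.indicator_of_mem hy, expMechanism, PMF.normalize_apply]
  -- The weight and the normalizing constant each cost one factor `exp (ε / 2)`.
  set a := ENNReal.ofReal (Real.exp (ε / 2)) with ha
  have ha0 : a ≠ 0 := by simp [ha, Real.exp_pos]
  have hsum : ∑' y, expWeight ε s (q x₂) y ≤ a * ∑' y, expWeight ε s (q x₁) y := by
    rw [← ENNReal.tsum_mul_left]
    exact ENNReal.tsum_le_tsum fun y => expWeight_le_mul hε s (hq x₁ x₂ hx y).2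
  have hinv : (∑' y, expWeight ε s (q x₁) y)⁻¹ ≤ a * (∑' y, expWeight ε s (q x₂) y)⁻¹ := by
    rw [← div_eq_mul_inv, ENNReal.le_div_iff_mul_le
      (Or.inl (tsum_expWeight_ne_zero ε hs _)) (Or.inl (tsum_expWeight_ne_top ε s _)),
      mul_comm, ← div_eq_mul_inv]
    exact ENNReal.div_le_of_le_mul hsum
  have haa : ENNReal.ofReal (Real.exp ε) = a * a := by
    rw [ha, ← ENNReal.ofReal_mul (Real.exp_pos _).le, ← Real.exp_add, add_halves]
  calc expWeight ε s (q x₁) y * (∑' y, expWeight ε s (q x₁) y)⁻¹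
      ≤ (a * expWeight ε s (q x₂) y) * (a * (∑' y, expWeight ε s (q x₂) y)⁻¹) :=
        mul_le_mul' (expWeight_le_mul hε s (hq x₁ x₂ hx y).1) hinv
    _ = _ := by rw [haa]; ring

/-- The exponential mechanism misses the score of any candidate `y₀` by more than `t` with
probability at most `|s| exp (-ε t / 2)`. -/
theorem expMechanism_toOuterMeasure_lt_le [Fintype Y] {ε : ℝ} (hε : 0 ≤ ε) (s : Finset Y) (hs : s.Nonempty)
    (q : Y → ℝ) {y₀ : Y} (hy₀ : y₀ ∈ s) (t : ℝ) :
    (expMechanism ε s hs q).toOuterMeasure {y | q y < q y₀ - t} ≤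
      ENNReal.ofReal (s.card * Real.exp (-(ε * t / 2))) := by
  -- The normalizer is at least the weight of `y₀`, so each bad candidate has probability at most
  -- `exp (-ε t / 2)`.
  have hw : ENNReal.ofReal (Real.exp (ε * q y₀ / 2)) ≤ ∑' y, expWeight ε s q y := by
    refine le_trans (le_of_eq ?_) (ENNReal.le_tsum y₀)
    simp [expWeight, hy₀]
  rw [PMF.toOuterMeasure_apply, tsum_fintype]
  have hpt : ∀ y, Set.indicator {y | q y < q y₀ - t} (expMechanism ε s hs q) y ≤
      (s : Set Y).indicator (fun _ => ENNReal.ofReal (Real.exp (-(ε * t / 2)))) y := by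
    intro y
    by_cases hy : y ∈ {y | q y < q y₀ - t}
    swap
    · simp [Set.indicator_of_notMem hy]
    rw [Set.indicator_of_mem hy, expMechanism, PMF.normalize_apply]
    by_cases hys : y ∈ (s : Set Y)
    swap
    · simp [expWeight, hys]
    rw [Set.indicator_of_mem hys, ← div_eq_mul_inv]
    refine ENNReal.div_le_of_le_mul (le_trans ?_ (mul_le_mul_right hw _))
    rw [expWeight, Set.indicator_of_mem hys, ← ENNReal.ofReal_mul (Real.exp_pos _).le,
      ← Real.exp_add]
    refine ENNReal.ofReal_le_ofReal (Real.exp_le_exp.2 ?_)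
    have hlt : q y < q y₀ - t := hy
    nlinarith [mul_le_mul_of_nonneg_left hlt.le hε]
  refine (Finset.sum_le_sum fun y _ => hpt y).trans (le_of_eq ?_)
  classical
  rw [Finset.sum_indicator_subset _ (Finset.subset_univ s), Finset.sum_const, nsmul_eq_mul,
    ENNReal.ofReal_mul (Nat.cast_nonneg _), ENNReal.ofReal_natCast]

/-- Utility of the exponential mechanism, in terms of the probability of success. -/
theorem le_expMechanism_toOuterMeasure [Fintype Y] {ε : ℝ} (hε : 0 ≤ ε) (s : Finset Y) (hs : s.Nonempty)
    (q : Y → ℝ) {y₀ : Y} (hy₀ : y₀ ∈ s) {t δ : ℝ}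
    (hδ : s.card * Real.exp (-(ε * t / 2)) ≤ δ) :
    1 - δ ≤ ((expMechanism ε s hs q).toOuterMeasure {y | q y₀ - t ≤ q y}).toReal := by
  set P := expMechanism ε s hs q
  have hδ0 : 0 ≤ δ := le_trans (by positivity) hδ
  have htop : ∀ E : Set Y, P.toOuterMeasure E ≤ 1 := fun E => by
    refine (P.toOuterMeasure.mono (Set.subset_univ E)).trans (le_of_eq ?_)
    exact (P.toOuterMeasure_apply_eq_one_iff _).2 (Set.subset_univ _)
  have hbad := (expMechanism_toOuterMeasure_lt_le hε s hs q hy₀ t).trans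
    (ENNReal.ofReal_le_ofReal hδ)
  have hone : (1 : ENNReal) ≤
      P.toOuterMeasure {y | q y₀ - t ≤ q y} + P.toOuterMeasure {y | q y < q y₀ - t} := by
    refine le_trans (le_of_eq ?_) (MeasureTheory.measure_union_le _ _)
    refine ((P.toOuterMeasure_apply_eq_one_iff _).2 fun y _ => ?_).symm
    exact le_or_gt (q y₀ - t) (q y)
  have hreal := ENNReal.toReal_mono
    (ENNReal.add_ne_top.2 ⟨((htop _).trans_lt ENNReal.one_lt_top).ne, ENNReal.ofReal_ne_top⟩)
    (hone.trans (add_le_add_right hbad (P.toOuterMeasure {y | q y₀ - t ≤ q y})))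
  rw [ENNReal.toReal_add ((htop _).trans_lt ENNReal.one_lt_top).ne ENNReal.ofReal_ne_top,
    ENNReal.toReal_ofReal hδ0, ENNReal.toReal_one] at hreal
  linarith

end ExponentialMechanism

/-! ### Coverage -/

namespace SetSystem

variable {n m : ℕ}

theorem coverage_le_add_card {S₁ S₂ : SetSystem n m} {D : Finset (Fin n)}
    (h : ∀ j, S₁ j ⊆ S₂ j ∪ D) (J : Finset (Fin m)) :
    S₁.coverage J ≤ S₂.coverage J + D.card := by
  refine (Finset.card_le_card fun u hu => ?_).trans (Finset.card_union_le _ _)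
  obtain ⟨j, hj, huj⟩ := Finset.mem_biUnion.1 hu
  rcases Finset.mem_union.1 (h j huj) with h' | h'
  · exact Finset.mem_union_left _ (Finset.mem_biUnion.2 ⟨j, hj, h'⟩)
  · exact Finset.mem_union_right _ h'

theorem coverage_le_of_edgeNeighbor {S₁ S₂ : SetSystem n m} (h : EdgeNeighbor S₁ S₂)
    (J : Finset (Fin m)) :
    S₁.coverage J ≤ S₂.coverage J + 1 ∧ S₂.coverage J ≤ S₁.coverage J + 1 := by
  obtain ⟨i, hi, hne⟩ := h
  rw [← hi]
  constructor <;>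
  · refine coverage_le_add_card (fun j u hu => ?_) J
    by_cases hj : j = i
    · subst hj
      simp only [Finset.mem_union, Finset.mem_symmDiff]
      tauto
    · simp_all

/-- A private element may lie in `f` sets, but a union counts it once: the sensitivity is 1, not
`f`. -/
theorem coverage_restrict_le_of_nodeNeighbor (S : SetSystem n m) {R₁ R₂ : Finset (Fin n)}
    (h : NodeNeighbor R₁ R₂) (J : Finset (Fin m)) :
    (S.restrict R₁).coverage J ≤ (S.restrict R₂).coverage J + 1 ∧
      (S.restrict R₂).coverage J ≤ (S.restrict R₁).coverage J + 1 := by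
  rw [NodeNeighbor] at h
  rw [← h]
  constructor <;>
  · refine coverage_le_add_card (fun j u hu => ?_) J
    simp only [restrict, Finset.mem_union, Finset.mem_symmDiff, Finset.mem_inter] at hu ⊢
    tauto

theorem exists_coverage_eq_opt {k : ℕ} (hk : k ≤ m) (S : SetSystem n m) :
    ∃ J : Solution m k, S.coverage J.1 = S.opt k := by
  have hne : (Finset.powersetCard k (Finset.univ : Finset (Fin m))).Nonempty :=
    Finset.powersetCard_nonempty.2 (by simpa using hk)
  obtain ⟨J, hJ, h⟩ := Finset.exists_mem_eq_sup _ hne S.coverage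
  exact ⟨⟨J, (Finset.mem_powersetCard.1 hJ).2⟩, h.symm⟩

theorem opt_zero (S : SetSystem n m) : S.opt 0 = 0 := by
  simp [opt, coverage]

/-- The indices of the nonempty sets of a set system. -/
def support (S : SetSystem n m) : Finset (Fin m) :=
  Finset.univ.filter fun i => (S i).Nonempty

/-- Double counting of incidences: each nonempty set has at least one, each element at most
`maxDegree`. -/
theorem card_support_le (S : SetSystem n m) : S.support.card ≤ n * S.maxDegree := by
  calc S.support.card ≤ ∑ i, (S i).card := by
        rw [support, Finset.card_filter]
        refine Finset.sum_le_sum fun i _ => ?_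
        split_ifs with h
        · exact h.card_pos
        · exact Nat.zero_le _
    _ = ∑ u : Fin n, (Finset.univ.filter fun i : Fin m => u ∈ S i).card := by
        simp only [Finset.card_filter]
        rw [Finset.sum_comm]
        refine Finset.sum_congr rfl fun i _ => ?_
        rw [← Finset.card_filter, Finset.filter_univ_mem]
    _ ≤ ∑ _u : Fin n, S.maxDegree :=
        Finset.sum_le_sum fun u _ => Finset.le_sup
          (f := fun u : Fin n => (Finset.univ.filter fun i : Fin m => u ∈ S i).card)
          (Finset.mem_univ u)
    _ = n * S.maxDegree := by simp

theorem coverage_restrict_le_of_inter_support_subset (S : SetSystem n m) (R : Finset (Fin n))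
    {J J' : Finset (Fin m)} (h : J ∩ S.support ⊆ J') :
    (S.restrict R).coverage J ≤ (S.restrict R).coverage J' := by
  refine Finset.card_le_card fun u hu => ?_
  obtain ⟨j, hj, huj⟩ := Finset.mem_biUnion.1 hu
  refine Finset.mem_biUnion.2 ⟨j, h (Finset.mem_inter.2 ⟨hj, ?_⟩), huj⟩
  exact Finset.mem_filter.2 ⟨Finset.mem_univ _, u, (Finset.mem_inter.1 huj).1⟩

/-- A family of few solutions which contains an optimal one for every private set `R`. -/
theorem exists_candidates {k : ℕ} (hk : k ≤ m) (S : SetSystem n m) :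
    ∃ s : Finset (Solution m k), s.Nonempty ∧ s.card ≤ max 1 ((n * S.maxDegree) ^ k) ∧
      ∀ R : Finset (Fin n), ∃ J ∈ s, (S.restrict R).opt k ≤ (S.restrict R).coverage J.1 := by
  suffices H : ∃ s : Finset (Solution m k), s.card ≤ max 1 ((n * S.maxDegree) ^ k) ∧
      ∀ J : Solution m k, ∃ J' ∈ s, J.1 ∩ S.support ⊆ J'.1 by
    obtain ⟨s, hcard, h⟩ := H
    have hopt : ∀ R : Finset (Fin n),
        ∃ J ∈ s, (S.restrict R).opt k ≤ (S.restrict R).coverage J.1 := fun R => by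
      obtain ⟨J, hJ⟩ := (S.restrict R).exists_coverage_eq_opt hk
      obtain ⟨J', hJ', hsub⟩ := h J
      exact ⟨J', hJ', hJ ▸ S.coverage_restrict_le_of_inter_support_subset R hsub⟩
    obtain ⟨J, hJ, -⟩ := hopt ∅
    exact ⟨s, ⟨J, hJ⟩, hcard, hopt⟩
  -- If the support has at least `k` indices, `J ∩ S.support` can be padded inside it to size `k`.
  -- Otherwise one solution containing the whole support serves every `J`; this case needs the `max
  -- 1`.
  rcases le_or_gt k S.support.card with hle | hlt
  · refine ⟨Finset.univ.filter fun J => J.1 ⊆ S.support, le_max_of_le_right ?_, fun J => ?_⟩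
    · calc _ ≤ (Finset.powersetCard k S.support).card := by
            refine Finset.card_le_card_of_injOn (fun J => J.1) (fun J hJ => ?_)
              Subtype.val_injective.injOn
            exact Finset.mem_powersetCard.2 ⟨(Finset.mem_filter.1 hJ).2, J.2⟩
        _ = S.support.card.choose k := Finset.card_powersetCard _ _
        _ ≤ S.support.card ^ k := Nat.choose_le_pow _ _
        _ ≤ (n * S.maxDegree) ^ k := Nat.pow_le_pow_left S.card_support_le k
    · obtain ⟨J', h₁, h₂, h₃⟩ := Finset.exists_subsuperset_card_eq
        (Finset.inter_subset_right : J.1 ∩ S.support ⊆ S.support)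
        ((Finset.card_le_card Finset.inter_subset_left).trans_eq J.2) hle
      exact ⟨⟨J', h₃⟩, Finset.mem_filter.2 ⟨Finset.mem_univ _, h₂⟩, h₁⟩
  · obtain ⟨J', h₁, -, h₃⟩ := Finset.exists_subsuperset_card_eq
      (Finset.subset_univ S.support) hlt.le (by simpa using hk)
    exact ⟨{⟨J', h₃⟩}, by simp, fun J =>
      ⟨_, Finset.mem_singleton_self _, Finset.inter_subset_right.trans h₁⟩⟩

/-- A choice of a small family of solutions which contains an optimal one for every `R`. -/
noncomputable def candidates {k : ℕ} (hk : k ≤ m) (S : SetSystem n m) :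
    Finset (Solution m k) :=
  (S.exists_candidates hk).choose

theorem candidates_nonempty {k : ℕ} (hk : k ≤ m) (S : SetSystem n m) :
    (S.candidates hk).Nonempty :=
  (S.exists_candidates hk).choose_spec.1

end SetSystem

theorem Solution.univ_nonempty {m k : ℕ} (hk : k ≤ m) :
    (Finset.univ : Finset (Solution m k)).Nonempty := by
  -- A dummy system; only the existence of a `k`-subset matters.
  obtain ⟨J, -⟩ := SetSystem.exists_coverage_eq_opt hk (fun _ => ∅ : SetSystem 0 m)
  exact ⟨J, Finset.mem_univ J⟩

theorem Solution.card_univ_le {m k : ℕ} :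
    (Finset.univ : Finset (Solution m k)).card ≤ m ^ k := by
  rw [Finset.card_univ, Fintype.card_finset_len, Fintype.card_fin]
  exact Nat.choose_le_pow _ _

/-! ### The two algorithms -/

/-- The node-private algorithm: the exponential mechanism, with the coverage as score, on a small
family of solutions determined by the public set system. -/
noncomputable def nodeExpMechanism : NodeAlgorithm := fun _ _ _ hk ε S R =>
  expMechanism ε (S.candidates hk) (S.candidates_nonempty hk)
    fun J => ((S.restrict R).coverage J.1 : ℝ)

/-- The edge-private algorithm: the exponential mechanism, with the coverage as score, on all
solutions. -/
noncomputable def edgeExpMechanism : EdgeAlgorithm := fun _ _ _ hk ε S =>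
  expMechanism ε Finset.univ (Solution.univ_nonempty hk) fun J => (S.coverage J.1 : ℝ)

/-! ### Privacy of the two mechanisms. -/

theorem isDP_nodeExpMechanism {n m k : ℕ} (hk : k ≤ m) {ε : ℝ} (hε : 0 ≤ ε)
    (S : SetSystem n m) : IsDP NodeNeighbor ε (nodeExpMechanism n m k hk ε S) := by
  refine isDP_expMechanism hε _ _ _ fun R₁ R₂ h J => ?_
  exact_mod_cast S.coverage_restrict_le_of_nodeNeighbor h J.1

theorem isDP_edgeExpMechanism {n m k : ℕ} (hk : k ≤ m) {ε : ℝ} (hε : 0 ≤ ε) :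
    IsDP EdgeNeighbor ε (edgeExpMechanism n m k hk ε) := by
  refine isDP_expMechanism hε _ _ _ fun S₁ S₂ h J => ?_
  exact_mod_cast SetSystem.coverage_le_of_edgeNeighbor h J.1

/-- Proved from node sensitivity 1 directly, so no factor `f` is lost to group privacy. -/
theorem isDP_edgeExpMechanism_restrict {n m k : ℕ} (hk : k ≤ m) {ε : ℝ} (hε : 0 ≤ ε)
    (S : SetSystem n m) :
    IsDP NodeNeighbor ε fun R => edgeExpMechanism n m k hk ε (S.restrict R) := by
  refine isDP_expMechanism hε _ _ _ fun R₁ R₂ h J => ?_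
  exact_mod_cast S.coverage_restrict_le_of_nodeNeighbor h J.1

theorem IsDP.mono {X Y : Type} {Neighbor : X → X → Prop} {ε ε' : ℝ} {M : X → PMF Y}
    (h : IsDP Neighbor ε M) (hε : ε ≤ ε') : IsDP Neighbor ε' M := fun x₁ x₂ hx E =>
  (h x₁ x₂ hx E).trans
    (mul_le_mul_left (ENNReal.ofReal_le_ofReal (Real.exp_le_exp.2 hε)) _)

/-! ### Approximation guarantees. -/

theorem isApproxWithProb_of_nonpos {n m k : ℕ} (S : SetSystem n m) (α β : ℝ) {p : ℝ}
    (hp : p ≤ 0) (P : PMF (Solution m k)) : IsApproxWithProb S α β p P :=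
  hp.trans ENNReal.toReal_nonneg

theorem isApproxWithProb_of_opt_eq_zero {n m k : ℕ} {S : SetSystem n m} (hS : S.opt k = 0)
    (α : ℝ) {β p : ℝ} (hβ : 0 ≤ β) (hp : p ≤ 1) (P : PMF (Solution m k)) :
    IsApproxWithProb S α β p P := by
  unfold IsApproxWithProb
  rw [(P.toOuterMeasure_apply_eq_one_iff _).2, ENNReal.toReal_one]
  · exact hp
  · intro J _
    simp only [hS, Nat.cast_zero, mul_zero, zero_sub, Set.mem_ofPred_eq]
    exact (neg_nonpos.2 hβ).trans (Nat.cast_nonneg _)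

/-- The exponential mechanism with coverage scores, on at most `N` candidates one of which is
optimal, approximates Max Cover with additive error `2 (log N + 2 log n) / ε`. -/
theorem isApproxWithProb_expMechanism {n m k : ℕ} (hn : 1 ≤ n) (S : SetSystem n m)
    {ε : ℝ} (hε : 0 < ε) {s : Finset (Solution m k)} (hs : s.Nonempty)
    (hopt : ∃ J ∈ s, S.opt k ≤ S.coverage J.1) {N : ℕ} (hN : s.card ≤ N)
    {α β : ℝ} (hα : α ≤ 1) (hβ : 2 * (Real.log N + 2 * Real.log n) / ε ≤ β) :
    IsApproxWithProb S α β (1 - 1 / (n : ℝ) ^ 2)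
      (expMechanism ε s hs fun J => (S.coverage J.1 : ℝ)) := by
  obtain ⟨J₀, hJ₀, hle⟩ := hopt
  have hn0 : (0 : ℝ) < n := by exact_mod_cast hn
  have hN0 : (0 : ℝ) < N := by exact_mod_cast hs.card_pos.trans_le hN
  have hδ : (s.card : ℝ) * Real.exp (-(ε * β / 2)) ≤ 1 / (n : ℝ) ^ 2 := by
    rw [div_le_iff₀ hε] at hβ
    calc (s.card : ℝ) * Real.exp (-(ε * β / 2))
        ≤ N * Real.exp (-(Real.log N + 2 * Real.log n)) := by
          gcongr
          linarith
      _ = 1 / (n : ℝ) ^ 2 := by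
          rw [neg_add, Real.exp_add, Real.exp_neg, Real.exp_log hN0, Real.exp_neg,
            show (2 : ℝ) * Real.log n = Real.log n + Real.log n by ring, Real.exp_add,
            Real.exp_log hn0]
          field_simp
  refine (le_expMechanism_toOuterMeasure hε.le s hs _ hJ₀ hδ).trans
    (ENNReal.toReal_mono ?_ (MeasureTheory.OuterMeasure.mono _ fun J hJ => ?_))
  · refine (lt_of_le_of_lt (PMF.toOuterMeasure_mono _ (t := Set.univ)
      (Set.inter_subset_left.trans (Set.subset_univ _))) ?_).ne
    rw [((PMF.toOuterMeasure_apply_eq_one_iff _ _).2 (Set.subset_univ _))]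
    exact ENNReal.one_lt_top
  · have h₁ : (S.coverage J₀.1 : ℝ) - β ≤ S.coverage J.1 := hJ
    have h₂ : (S.opt k : ℝ) ≤ S.coverage J₀.1 := by exact_mod_cast hle
    have h₃ : α * (S.opt k : ℝ) ≤ S.opt k :=
      mul_le_of_le_one_left (Nat.cast_nonneg _) hα
    show α * (S.opt k : ℝ) - β ≤ S.coverage J.1
    linarith

theorem isApproxWithProb_nodeExpMechanism {n m k : ℕ} (hn : 1 ≤ n) (hk : k ≤ m) {ε : ℝ}
    (hε : 0 < ε) (S : SetSystem n m) (R : Finset (Fin n)) {α : ℝ} (hα : α ≤ 1) :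
    IsApproxWithProb (S.restrict R) α
      (10 * Real.log (n : ℝ) * ((S.maxDegree : ℝ) * (k : ℝ) / ε))
      (1 - 1 / (n : ℝ) ^ 2) (nodeExpMechanism n m k hk ε S R) := by
  have hp : 1 - 1 / (n : ℝ) ^ 2 ≤ 1 := sub_le_self _ (by positivity)
  have hlog : 0 ≤ Real.log n := Real.log_natCast_nonneg n
  have hβ : 0 ≤ 10 * Real.log (n : ℝ) * ((S.maxDegree : ℝ) * (k : ℝ) / ε) := by positivity
  obtain ⟨hne, hcard, hopt⟩ := (S.exists_candidates hk).choose_spec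
  -- For `n = 1` the allowed error is 0 since `log 1 = 0`, but so is the required probability.
  rcases hn.eq_or_lt with rfl | hn2
  · exact isApproxWithProb_of_nonpos _ _ _ (by simp) _
  rcases k.eq_zero_or_pos with rfl | hk0
  · exact isApproxWithProb_of_opt_eq_zero (SetSystem.opt_zero _) _ hβ hp _
  rcases S.maxDegree.eq_zero_or_pos with hf | hf
  · refine isApproxWithProb_of_opt_eq_zero ?_ _ hβ hp _
    have hS : S.support = ∅ := by
      have := S.card_support_le
      rw [hf, mul_zero, Nat.le_zero, Finset.card_eq_zero] at this
      exact this
    obtain ⟨J, hJ⟩ := (S.restrict R).exists_coverage_eq_opt hk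
    rw [← hJ, ← Nat.le_zero]
    exact S.coverage_restrict_le_of_inter_support_subset R (J' := ∅) (by simp [hS])
  replace hcard := hcard.trans_eq (max_eq_right (Nat.one_le_pow _ _ (by positivity)))
  refine isApproxWithProb_expMechanism hn _ hε hne (hopt R) hcard hα ?_
  -- With `L = log n`, this gives `k log f ≤ k f ≤ 2 k f L`, so `2 (k L + k log f + 2 L) ≤ (2 + 4 +
  -- 4) k f L`: the constant 10.
  have hlog2 : 1 / 2 ≤ Real.log n := by
    have h := Real.log_le_log (by norm_num) (show (2 : ℝ) ≤ n by exact_mod_cast hn2)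
    linarith [Real.log_two_gt_d9]
  have hf1 : (1 : ℝ) ≤ S.maxDegree := by exact_mod_cast hf
  have hk1 : (1 : ℝ) ≤ k := by exact_mod_cast hk0
  have hn0 : (n : ℝ) ≠ 0 := by positivity
  rw [← mul_div_assoc]
  refine div_le_div_of_nonneg_right ?_ hε.le
  push_cast
  rw [Real.log_pow, Real.log_mul hn0 (by positivity)]
  have hlogf : Real.log S.maxDegree ≤ S.maxDegree := Real.log_le_self (by positivity)
  have h₁ : (k : ℝ) * Real.log n ≤ k * S.maxDegree * Real.log n := by
    have := mul_le_mul_of_nonneg_left hf1 (mul_nonneg (Nat.cast_nonneg k) hlog)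
    linarith
  have h₂ : Real.log n ≤ k * Real.log n := le_mul_of_one_le_left hlog hk1
  have h₃ : (k : ℝ) * Real.log S.maxDegree ≤ k * S.maxDegree :=
    mul_le_mul_of_nonneg_left hlogf (by positivity)
  have h₄ : (k : ℝ) * S.maxDegree * (1 / 2) ≤ k * S.maxDegree * Real.log n :=
    mul_le_mul_of_nonneg_left hlog2 (by positivity)
  linarith

theorem isApproxWithProb_edgeExpMechanism {n m k : ℕ} (hn : 1 ≤ n) (hk : k ≤ m) {ε : ℝ}
    (hε : 0 < ε) (S : SetSystem n m) {α : ℝ} (hα : α ≤ 1) :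
    IsApproxWithProb S α (10 * Real.log ((n : ℝ) + (m : ℝ)) * ((k : ℝ) / ε))
      (1 - 1 / (n : ℝ) ^ 2) (edgeExpMechanism n m k hk ε S) := by
  have hn1 : (1 : ℝ) ≤ n := by exact_mod_cast hn
  have hm0 : (0 : ℝ) ≤ m := Nat.cast_nonneg m
  have hlog : 0 ≤ Real.log ((n : ℝ) + m) := Real.log_nonneg (by linarith)
  rcases k.eq_zero_or_pos with rfl | hk0
  · exact isApproxWithProb_of_opt_eq_zero (SetSystem.opt_zero _) _ (by positivity)
      (sub_le_self _ (by positivity)) _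
  have hm1 : (1 : ℝ) ≤ m := by exact_mod_cast hk0.trans_le hk
  have hk1 : (1 : ℝ) ≤ k := by exact_mod_cast hk0
  obtain ⟨J, hJ⟩ := S.exists_coverage_eq_opt hk
  refine isApproxWithProb_expMechanism hn S hε _ ⟨J, Finset.mem_univ J, hJ.ge⟩
    Solution.card_univ_le hα ?_
  rw [← mul_div_assoc]
  refine div_le_div_of_nonneg_right ?_ hε.le
  push_cast
  rw [Real.log_pow]
  have h₁ : (k : ℝ) * Real.log m ≤ k * Real.log ((n : ℝ) + m) := by gcongr; linarith
  have h₂ : Real.log n ≤ Real.log ((n : ℝ) + m) := by gcongr; linarith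
  have h₃ : Real.log ((n : ℝ) + m) ≤ k * Real.log ((n : ℝ) + m) :=
    le_mul_of_one_le_left hlog hk1
  -- The bounds above already give constant 6; this supplies the slack up to 10.
  have h₄ : 0 ≤ k * Real.log ((n : ℝ) + m) := by positivity
  linarith

theorem mainTheorem4 :
    ∃ c : ℕ, ∀ η : ℝ, 0 < η → ∃ C : ℝ, 0 < C ∧
      (∃ A : NodeAlgorithm,
        ∀ (n m k : ℕ) (_ : 1 ≤ n) (hk : k ≤ m) (ε : ℝ) (_ : 0 < ε) (S : SetSystem n m),
          IsDP NodeNeighbor ε (A n m k hk ε S) ∧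
          ∀ R : Finset (Fin n),
            IsApproxWithProb (S.restrict R) (1 - 1 / Real.exp 1 - η)
              (C * Real.log (n : ℝ) ^ c * ((S.maxDegree : ℝ) * (k : ℝ) / ε))
              (1 - 1 / (n : ℝ) ^ 2) (A n m k hk ε S R)) ∧
      (∃ B : EdgeAlgorithm,
        (∀ (n m k : ℕ) (hk : k ≤ m) (ε : ℝ), 0 < ε → IsDP EdgeNeighbor ε (B n m k hk ε)) ∧
        ∀ (n m k : ℕ) (_ : 1 ≤ n) (hk : k ≤ m) (ε : ℝ) (_ : 0 < ε) (S : SetSystem n m),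
          0 < S.maxDegree →
          IsDP NodeNeighbor ε
            (fun R => B n m k hk (ε / (S.maxDegree : ℝ)) (S.restrict R)) ∧
          ∀ R : Finset (Fin n),
            IsApproxWithProb (S.restrict R) (1 - 1 / Real.exp 1 - η)
              (C * Real.log ((n : ℝ) + (m : ℝ)) ^ c *
                ((S.maxDegree : ℝ) * (k : ℝ) / ε))
              (1 - 1 / (n : ℝ) ^ 2)
              (B n m k hk (ε / (S.maxDegree : ℝ)) (S.restrict R))) := by
  -- A single logarithm and a constant independent of `η` suffice.
  refine ⟨1, fun η hη => ⟨10, by norm_num, ?_⟩⟩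
  have hα : 1 - 1 / Real.exp 1 - η ≤ 1 := by
    have : 0 < 1 / Real.exp 1 := by positivity
    linarith
  refine ⟨⟨nodeExpMechanism, fun n m k hn hk ε hε S =>
    ⟨isDP_nodeExpMechanism hk hε.le S, fun R => ?_⟩⟩, edgeExpMechanism,
    fun n m k hk ε hε => isDP_edgeExpMechanism hk hε.le, fun n m k hn hk ε hε S hf => ?_⟩
  · rw [pow_one]
    exact isApproxWithProb_nodeExpMechanism hn hk hε S R hα
  have hf1 : (1 : ℝ) ≤ S.maxDegree := by exact_mod_cast hf
  have hε' : 0 < ε / S.maxDegree := by positivity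
  -- The run is even `ε / f`-node private, and `ε / f ≤ ε` because `f ≥ 1`.
  refine ⟨(isDP_edgeExpMechanism_restrict hk hε'.le S).mono (div_le_self hε.le hf1),
    fun R => ?_⟩
  have h := isApproxWithProb_edgeExpMechanism hn hk hε' (S.restrict R) hα
  rwa [div_div_eq_mul_div, mul_comm (k : ℝ), ← pow_one (Real.log ((n : ℝ) + m))] at h
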